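/- For a convex function $f:(0,\infty)\to\mathbb R$ with $f(1)=0$ and probability measures $P,Q$ with densities $p,q$ with respect to a common dominating measure $\mu$, let $D_f(P\|Q)=\int q\,f(p/q)\,d\mu$, with the conventions $f(0)=\lim_{t\to0^+}f(t)$, $0f(0/0)=0$ and $0f(a/0)=a\lim_{u\to\infty}f(u)/u$ for $a>0$. Let $Q_X$ be a probability measure on a measurable space $\mathcal X$ with measurable singletons, not a point mass, and let $W_{Y|X}$ be a stochastic transformation (Markov kernel) from $\mathcal X$ to a measurable space $\mathcal Y$. Put $P_Y=P_XW_{Y|X}$, $Q_Y=Q_XW_{Y|X}$ and $$\mu_f(Q_X,W_{Y|X})=\sup_{P_X:\;0<D_f(P_X\|Q_X)<\infty}\frac{D_f(P_Y\|Q_Y)}{D_f(P_X\|Q_X)}.$$ Write $\mu_{\chi^2}$ for the case $f(t)=(t-1)^2$, and for $\alpha\in(0,1]$ and $t>0$ let $$k_\alpha(t)=t\ln t-t\ln(\alpha+(1-\alpha)t),\qquad s_\alpha(t)=\alpha t\ln t-(\alpha t+1-\alpha)\ln(\alpha+(1-\alpha)t).$$ Then for every $\alpha\in(0,1]$, $$\mu_{\chi^2}(Q_X,W_{Y|X})\le\mu_{k_\alpha}(Q_X,W_{Y|X}),\qquad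 \mu_{\chi^2}(Q_X,W_{Y|X})\le\mu_{s_\alpha}(Q_X,W_{Y|X}).$$ If moreover $Q_X$ is supported on finitely many points, with minimal positive mass $Q_{\min}$, and, in the case $\alpha<1$, every point of $\mathcal X$ has positive $Q_X$-mass (that is, $\mathcal X$ is the support of $Q_X$), then $$\mu_{k_\alpha}(Q_X,W_{Y|X})\le\frac{1}{\alpha\,Q_{\min}}\,\mu_{\chi^2}(Q_X,W_{Y|X}),$$ $$\mu_{s_\alpha}(Q_X,W_{Y|X})\le\frac{(1-\alpha)\ln\frac1\alpha+2\alpha-1}{(1-3\alpha+3\alpha^2)\,Q_{\min}}\,\mu_{\chi^2}(Q_X,W_{Y|X}).$$ -/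

import Mathlib

open MeasureTheory ProbabilityTheory Filter Topology Set

noncomputable section

/-- The integrand `q f(p/q)` of an `f`-divergence, with the conventions
`f(0) = lim_{t → 0+} f(t)`, `0 f(0/0) = 0` and `0 f(a/0) = a lim_{u → ∞} f(u)/u` for `a > 0`.
Only the values of `f` on `(0, ∞)` matter. For convex `f` both limits exist in `[-∞, ∞]`. -/
def divIntegrand (f : ℝ → ℝ) (p q : ℝ) : EReal :=
  if q = 0 then
    if p = 0 then 0
    else (p : EReal) * limUnder atTop (fun u : ℝ => ((f u / u : ℝ) : EReal))
  else
    if p = 0 then (q : EReal) * limUnder (𝓝[>] (0 : ℝ)) (fun t : ℝ => (f t : EReal))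
    else ((q * f (p / q) : ℝ) : EReal)

/-- The Lebesgue integral of an extended-real valued function: the integral of the positive part
minus the integral of the negative part. -/
def erealIntegral {Z : Type*} [MeasurableSpace Z] (μ : Measure Z) (g : Z → EReal) : EReal :=
  ((∫⁻ z, (g z).toENNReal ∂μ : ENNReal) : EReal) - ((∫⁻ z, (-g z).toENNReal ∂μ : ENNReal) : EReal)

/-- The `f`-divergence of `P` from `Q`, computed with densities with respect to `μ`. -/
def fDivWrt {Z : Type*} [MeasurableSpace Z] (μ : Measure Z) (f : ℝ → ℝ) (P Q : Measure Z) :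
    EReal :=
  erealIntegral μ fun z => divIntegrand f (P.rnDeriv μ z).toReal (Q.rnDeriv μ z).toReal

/-- The `f`-divergence `D_f(P ‖ Q)`. Its value does not depend on the dominating measure;
`P + Q` is used. -/
def fDiv {Z : Type*} [MeasurableSpace Z] (f : ℝ → ℝ) (P Q : Measure Z) : EReal :=
  fDivWrt (P + Q) f P Q

/-- The contraction coefficient `μ_f(Q_X, W_{Y|X})`: the supremum of
`D_f(P_X W ‖ Q_X W) / D_f(P_X ‖ Q_X)` over the probability measures `P_X` with
`0 < D_f(P_X ‖ Q_X) < ∞`. -/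
def contractionCoeff {X Y : Type*} [MeasurableSpace X] [MeasurableSpace Y]
    (f : ℝ → ℝ) (Q : Measure X) (W : Kernel X Y) : EReal :=
  ⨆ (P : Measure X) (_ : IsProbabilityMeasure P ∧ 0 < fDiv f P Q ∧ fDiv f P Q < ⊤),
    fDiv f (P.bind W) (Q.bind W) / fDiv f P Q

/-- The generator of the chi-squared divergence. -/
def chiSqFun (t : ℝ) : ℝ := (t - 1) ^ 2

/-- The generator `k_α` of the `α`-skew `K`-divergence. -/
def kFun (α t : ℝ) : ℝ := t * Real.log t - t * Real.log (α + (1 - α) * t)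

/-- The generator `s_α` of the divergence
`S_α(P ‖ Q) = α D(P ‖ (1-α)P + αQ) + (1-α) D(Q ‖ (1-α)P + αQ)`. -/
def sFun (α t : ℝ) : ℝ :=
  α * t * Real.log t - (α * t + 1 - α) * Real.log (α + (1 - α) * t)

/-- `Q_min`: the smallest positive mass of a point (a minimum if `Q` is finitely supported). -/
def minMass {X : Type*} [MeasurableSpace X] (Q : Measure X) : ℝ :=
  sInf {r : ℝ | 0 < r ∧ ∃ x : X, Q.real {x} = r}

end

open InformationTheory

/-! Only the behaviour of a generator near `t = 1` and its growth at `0` and `∞` matter. Adding `l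
(t - 1)` does not change a divergence when `P ≪ Q`, because densities integrate to one. After
removal of its tangent at `1`, each of `k_α` and `s_α` is a combination of perspectives of `klFun`,
and lies between `c (t - 1)² / max t 1` and `c (t - 1)² / min t 1` (`ComparableChiSq`).

Lower bounds on `μ_f`: replace `P` by `(1 - ε) Q + ε P`, whose density is `1 + ε (g - 1)`. This
commutes with the channel. The input divergence is at most `c ε² χ² / (1 - ε)`, and the output
divergence divided by `c ε²` has lower limit at least `χ²` by Fatou. Hence every `χ²` ratio is at
most `μ_f` (`contractionCoeff_chiSq_le`).

Upper bounds on `μ_f`: a global bound `f(t) - l (t - 1) ≤ A (t - 1)²` controls the output divergence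
by `χ²`. At the input, with `N = ∫ |g - 1| dQ`, Pinsker gives `D_f ≥ c N²` and the finite support
gives `Q_min χ² ≤ N² / 2`. Therefore `2 c Q_min χ² ≤ D_f`, and the loss is the factor `A / (2 c
Q_min)` (`contractionCoeff_le_mul_chiSq`). -/

/-! ### Scalar inequalities for `klFun` and its perspective -/

lemma nonneg_of_deriv_nonneg_of_one {u u' : ℝ → ℝ} (hc : ContinuousOn u (Ici 1))
    (hd : ∀ x, 1 < x → HasDerivAt u (u' x) x) (hpos : ∀ x, 1 < x → 0 ≤ u' x) (h1 : u 1 = 0)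
    {x : ℝ} (hx : 1 ≤ x) : 0 ≤ u x := by
  have hm : MonotoneOn u (Ici 1) := by
    refine monotoneOn_of_deriv_nonneg (convex_Ici 1) hc ?_ ?_
    · intro y hy
      rw [interior_Ici] at hy
      exact (hd y hy).differentiableAt.differentiableWithinAt
    · intro y hy
      rw [interior_Ici] at hy
      rw [(hd y hy).deriv]
      exact hpos y hy
  rw [← h1]
  exact hm self_mem_Ici hx hx

lemma nonneg_of_deriv_nonpos_of_one {a : ℝ} {u u' : ℝ → ℝ} (hc : ContinuousOn u (Icc a 1))
    (hd : ∀ x, a < x → x < 1 → HasDerivAt u (u' x) x) (hneg : ∀ x, a < x → x < 1 → u' x ≤ 0)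
    (h1 : u 1 = 0) {x : ℝ} (hx : a ≤ x) (hx1 : x ≤ 1) : 0 ≤ u x := by
  have hm : AntitoneOn u (Icc a 1) := by
    refine antitoneOn_of_deriv_nonpos (convex_Icc a 1) hc ?_ ?_
    · intro y hy
      rw [interior_Icc] at hy
      exact (hd y hy.1 hy.2).differentiableAt.differentiableWithinAt
    · intro y hy
      rw [interior_Icc] at hy
      rw [(hd y hy.1 hy.2).deriv]
      exact hneg y hy.1 hy.2
  rw [← h1]
  exact hm ⟨hx, hx1⟩ ⟨hx.trans hx1, le_rfl⟩ hx1

/-- The derivative is `log x - (1 - 1 / x) ≥ 0`. As the function vanishes at `1`, it has the sign of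
`x - 1`; up to a factor 4 it is the derivative needed for the Pinsker bound. -/
lemma monotoneOn_add_one_mul_log_sub :
    MonotoneOn (fun x : ℝ => (x + 1) * Real.log x - 2 * (x - 1)) (Ioi 0) := by
  have hd : ∀ x : ℝ, 0 < x → HasDerivAt (fun x : ℝ => (x + 1) * Real.log x - 2 * (x - 1))
      (Real.log x + (x + 1) * x⁻¹ - 2) x := by
    intro x hx
    have h1 := ((hasDerivAt_id x).add_const (1 : ℝ)).mul (Real.hasDerivAt_log hx.ne')
    have h2 := ((hasDerivAt_id x).sub_const (1 : ℝ)).const_mul 2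
    refine (h1.sub h2).congr_deriv ?_
    simp
  refine monotoneOn_of_deriv_nonneg (convex_Ioi 0) ?_ ?_ ?_
  · intro x hx
    exact (hd x hx).continuousAt.continuousWithinAt
  · intro x hx
    rw [interior_Ioi] at hx
    exact (hd x hx).differentiableAt.differentiableWithinAt
  · intro x hx
    rw [interior_Ioi] at hx
    rw [(hd x hx).deriv]
    have hx' : (0 : ℝ) < x := hx
    have h := Real.one_sub_inv_le_log_of_pos hx'
    have h2 : (x + 1) * x⁻¹ = 1 + x⁻¹ := by field_simp
    linarith

/-- The pointwise inequality behind Pinsker's inequality. -/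
lemma three_mul_sq_le_klFun {x : ℝ} (hx : 0 ≤ x) :
    3 * (x - 1) ^ 2 ≤ 2 * (x + 2) * klFun x := by
  set u : ℝ → ℝ := fun x => 2 * (x + 2) * klFun x - 3 * (x - 1) ^ 2 with hu
  have hcont : Continuous u := by
    have := continuous_klFun
    fun_prop
  have hd : ∀ x : ℝ, 0 < x →
      HasDerivAt u (4 * ((x + 1) * Real.log x - 2 * (x - 1))) x := by
    intro x hx
    have h1 := (((hasDerivAt_id x).add_const (2 : ℝ)).const_mul 2).mul (hasDerivAt_klFun hx.ne')
    have h2 := (((hasDerivAt_id x).sub_const (1 : ℝ)).pow 2).const_mul 3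
    refine (h1.sub h2).congr_deriv ?_
    simp only [id, klFun_apply]
    push_cast
    ring
  have h1 : u 1 = 0 := by simp [hu, klFun_one]
  have hm := monotoneOn_add_one_mul_log_sub
  have key : 0 ≤ u x := by
    rcases le_total x 1 with h | h
    · refine nonneg_of_deriv_nonpos_of_one hcont.continuousOn (fun y hy _ => hd y hy) ?_ h1 hx h
      intro y hy hy1
      have := hm (mem_Ioi.2 hy) (mem_Ioi.2 one_pos) hy1.le
      simp only [Real.log_one] at this
      linarith
    · refine nonneg_of_deriv_nonneg_of_one hcont.continuousOn
        (fun y hy => hd y (one_pos.trans hy)) ?_ h1 h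
      intro y hy
      have := hm (mem_Ioi.2 one_pos) (mem_Ioi.2 (one_pos.trans hy)) hy.le
      simp only [Real.log_one] at this
      linarith
  simp only [hu] at key
  linarith

lemma sq_le_max_mul_klFun {x : ℝ} (hx : 0 ≤ x) :
    (x - 1) ^ 2 ≤ 2 * max x 1 * klFun x := by
  have h := three_mul_sq_le_klFun hx
  have hk := klFun_nonneg hx
  have h3 : x + 2 ≤ 3 * max x 1 := by
    linarith [le_max_left x 1, le_max_right x 1]
  nlinarith [mul_le_mul_of_nonneg_right h3 hk]

/-- The difference of the two sides vanishes at `1`; its derivative is `-4 klFun` on `(0, 1)` and `2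
(x - 1 - log x)` beyond `1`. -/
lemma min_mul_klFun_le_sq {x : ℝ} (hx : 0 ≤ x) :
    2 * min x 1 * klFun x ≤ (x - 1) ^ 2 := by
  rcases le_total x 1 with h | h
  · rw [min_eq_left h]
    have hd : ∀ y : ℝ, 0 < y → y < 1 →
        HasDerivAt (fun y => (y - 1) ^ 2 - 2 * y * klFun y) (-4 * klFun y) y := by
      intro y hy _
      have h1 := (((hasDerivAt_id y).const_mul 2)).mul (hasDerivAt_klFun hy.ne')
      have h2 := (((hasDerivAt_id y).sub_const (1 : ℝ)).pow 2)
      refine (h2.sub h1).congr_deriv ?_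
      simp only [id, klFun_apply]
      push_cast
      ring
    have hcont : Continuous (fun y => (y - 1) ^ 2 - 2 * y * klFun y) := by
      have := continuous_klFun
      fun_prop
    have := nonneg_of_deriv_nonpos_of_one hcont.continuousOn hd
      (fun y hy _ => by linarith [klFun_nonneg hy.le]) (by simp [klFun_one]) hx h
    linarith
  · rw [min_eq_right h]
    have hd : ∀ y : ℝ, 1 < y →
        HasDerivAt (fun y => (y - 1) ^ 2 - 2 * klFun y) (2 * (y - 1) - 2 * Real.log y) y := by
      intro y hy
      have h1 := (hasDerivAt_klFun (one_pos.trans hy).ne').const_mul 2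
      have h2 := (((hasDerivAt_id y).sub_const (1 : ℝ)).pow 2)
      refine (h2.sub h1).congr_deriv ?_
      simp
    have hcont : Continuous (fun y => (y - 1) ^ 2 - 2 * klFun y) := by
      have := continuous_klFun
      fun_prop
    have := nonneg_of_deriv_nonneg_of_one hcont.continuousOn hd
      (fun y hy => by linarith [Real.log_le_sub_one_of_pos (one_pos.trans hy)])
      (by simp [klFun_one]) h
    linarith

/-- The perspective of `klFun`: `a log (a / b) - a + b`. -/
noncomputable def klPersp (a b : ℝ) : ℝ := b * klFun (a / b)

lemma klPersp_nonneg {a b : ℝ} (ha : 0 ≤ a) (hb : 0 < b) : 0 ≤ klPersp a b :=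
  mul_nonneg hb.le (klFun_nonneg (div_nonneg ha hb.le))

lemma klPersp_eq {a b : ℝ} (hb : 0 < b) :
    klPersp a b = a * Real.log a - a * Real.log b - a + b := by
  rcases eq_or_ne a 0 with rfl | ha
  · simp [klPersp, klFun_apply]
  · rw [klPersp, klFun_apply, Real.log_div ha hb.ne']
    field_simp
    ring

lemma three_mul_sq_le_klPersp {a b : ℝ} (ha : 0 ≤ a) (hb : 0 < b) :
    3 * (a - b) ^ 2 ≤ 2 * (a + 2 * b) * klPersp a b := by
  have h := mul_le_mul_of_nonneg_left (three_mul_sq_le_klFun (div_nonneg ha hb.le))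
    (sq_nonneg b)
  have e1 : b ^ 2 * (3 * (a / b - 1) ^ 2) = 3 * (a - b) ^ 2 := by field_simp
  have e2 : b ^ 2 * (2 * (a / b + 2) * klFun (a / b)) = 2 * (a + 2 * b) * klPersp a b := by
    rw [klPersp]; field_simp
  rwa [e1, e2] at h

lemma sq_le_max_mul_klPersp {a b : ℝ} (ha : 0 ≤ a) (hb : 0 < b) :
    (a - b) ^ 2 ≤ 2 * max a b * klPersp a b := by
  have h := mul_le_mul_of_nonneg_left (sq_le_max_mul_klFun (div_nonneg ha hb.le))
    (sq_nonneg b)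
  have e1 : b ^ 2 * ((a / b - 1) ^ 2) = (a - b) ^ 2 := by field_simp
  have e3 : b * max (a / b) 1 = max a b := by
    rw [mul_max_of_nonneg _ _ hb.le, mul_div_cancel₀ _ hb.ne', mul_one]
  have e2 : b ^ 2 * (2 * max (a / b) 1 * klFun (a / b)) = 2 * max a b * klPersp a b := by
    rw [klPersp, ← e3]; ring
  rwa [e1, e2] at h

lemma min_mul_klPersp_le_sq {a b : ℝ} (ha : 0 ≤ a) (hb : 0 < b) :
    2 * min a b * klPersp a b ≤ (a - b) ^ 2 := by
  have h := mul_le_mul_of_nonneg_left (min_mul_klFun_le_sq (div_nonneg ha hb.le))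
    (sq_nonneg b)
  have e1 : b ^ 2 * ((a / b - 1) ^ 2) = (a - b) ^ 2 := by field_simp
  have e3 : b * min (a / b) 1 = min a b := by
    rw [mul_min_of_nonneg _ _ hb.le, mul_div_cancel₀ _ hb.ne', mul_one]
  have e2 : b ^ 2 * (2 * min (a / b) 1 * klFun (a / b)) = 2 * min a b * klPersp a b := by
    rw [klPersp, ← e3]; ring
  rwa [e1, e2] at h

/-- The tangent-line form of Pinsker's inequality. -/
lemma pinsker_tangent_klPersp {a b : ℝ} (ha : 0 ≤ a) (hb : 0 < b) (r : ℝ) :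
    3 * (2 * r * |a - b| - r ^ 2 * (a + 2 * b)) ≤ 2 * klPersp a b := by
  have h := three_mul_sq_le_klPersp ha hb
  have hz : 0 < a + 2 * b := by linarith
  -- After multiplication by `a + 2 b`, the gap to `3 (a - b)²` is three times the square of `|a -
  -- b| - r (a + 2 b)`.
  refine le_of_mul_le_mul_left ?_ hz
  have := sq_abs (a - b)
  nlinarith [sq_nonneg (|a - b| - r * (a + 2 * b))]

/-- `(x - 1 - log x) / (x - 1) ^ 2` is largest at the left end of `[a, ∞)`. -/
lemma sub_one_sub_log_le {a x : ℝ} (ha : 0 < a) (ha1 : a ≤ 1) (hx : a ≤ x) :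
    (x - 1 - Real.log x) * (1 - a) ^ 2 ≤ (a - 1 - Real.log a) * (x - 1) ^ 2 := by
  set C := a - 1 - Real.log a with hC
  set D := (1 - a) ^ 2 with hD
  have hD0 : 0 ≤ D := sq_nonneg _
  have hCD : D ≤ 2 * C := by
    have h := sq_le_max_mul_klPersp zero_le_one ha
    rw [klPersp_eq ha, max_eq_left ha1] at h
    simp only [Real.log_one] at h
    rw [hD, hC]
    linarith
  set g : ℝ → ℝ := fun y => C * (y - 1) ^ 2 - (y - 1 - Real.log y) * D with hg
  have hd : ∀ y : ℝ, 0 < y → HasDerivAt g ((y - 1) * (2 * C - D * y⁻¹)) y := by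
    intro y hy
    have h1 := (((hasDerivAt_id y).sub_const (1 : ℝ)).pow 2).const_mul C
    have h2 := (((hasDerivAt_id y).sub_const (1 : ℝ)).sub (Real.hasDerivAt_log hy.ne')).mul_const D
    refine (h1.sub h2).congr_deriv ?_
    simp only [id]
    push_cast
    field_simp
  have hcont : ∀ s : Set ℝ, s ⊆ Ioi 0 → ContinuousOn g s := fun s hs y hy =>
    (hd y (hs hy)).continuousAt.continuousWithinAt
  have h1 : g 1 = 0 := by simp [hg]
  have hga : g a = 0 := by simp only [hg, hD, ← hC]; ring
  -- `g` vanishes at `a` and at `1`. On `[a, 1]` it first rises and then falls, turning where `2 C y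
  -- = D`; beyond `1` it rises, by `D ≤ 2 C`.
  have key : 0 ≤ g x := by
    rcases le_total 1 x with h | h
    · refine nonneg_of_deriv_nonneg_of_one (hcont _ fun y hy => one_pos.trans_le (mem_Ici.1 hy))
        (fun y hy => hd y (one_pos.trans hy)) (fun y hy => ?_) h1 h
      have : D * y⁻¹ ≤ D := mul_le_of_le_one_right hD0 (inv_le_one_of_one_le₀ hy.le)
      exact mul_nonneg (by linarith) (by linarith)
    · have hx0 : 0 < x := ha.trans_le hx
      rcases le_total (2 * C * x) D with h2 | h2
      · have hm : MonotoneOn g (Icc a x) := by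
          refine monotoneOn_of_deriv_nonneg (convex_Icc a x)
            (hcont _ fun y hy => ha.trans_le hy.1) ?_ ?_
          · intro y hy
            rw [interior_Icc] at hy
            exact (hd y (ha.trans hy.1)).differentiableAt.differentiableWithinAt
          · intro y hy
            rw [interior_Icc] at hy
            have hy0 : 0 < y := ha.trans hy.1
            rw [(hd y hy0).deriv]
            refine mul_nonneg_of_nonpos_of_nonpos (by linarith [hy.2]) ?_
            rw [sub_nonpos, ← div_eq_mul_inv, le_div_iff₀ hy0]
            refine le_trans ?_ h2
            exact mul_le_mul_of_nonneg_left hy.2.le (hD0.trans hCD)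
        rw [← hga]
        exact hm ⟨le_rfl, hx⟩ ⟨hx, le_rfl⟩ hx
      · refine nonneg_of_deriv_nonpos_of_one (hcont _ fun y hy => hx0.trans_le hy.1)
          (fun y hy _ => hd y (hx0.trans hy)) (fun y hy hy1 => ?_) h1 le_rfl h
        have hy0 : 0 < y := hx0.trans hy
        refine mul_nonpos_of_nonpos_of_nonneg (by linarith) ?_
        rw [sub_nonneg, ← div_eq_mul_inv, div_le_iff₀ hy0]
        refine h2.trans ?_
        exact mul_le_mul_of_nonneg_left hy.le (hD0.trans hCD)
  simp only [hg] at key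
  linarith

/-! ### Comparison with the chi-squared generator -/

/-- `f` lies within factors `max 1 t` and `1 / min 1 t` of `c (t - 1) ^ 2`, up to the linear term
`l (t - 1)`, and `f 0` is the limit of `f` at `0`. -/
structure ComparableChiSq (f : ℝ → ℝ) (c l : ℝ) : Prop where
  measurable : Measurable f
  tendsto_zero : Tendsto f (𝓝[>] 0) (𝓝 (f 0))
  pos : 0 < c
  lower : ∀ t, 0 ≤ t → c * (t - 1) ^ 2 ≤ max t 1 * (f t - l * (t - 1))
  upper : ∀ t, 0 ≤ t → min t 1 * (f t - l * (t - 1)) ≤ c * (t - 1) ^ 2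

lemma ComparableChiSq.nonneg {f : ℝ → ℝ} {c l : ℝ} (hf : ComparableChiSq f c l) {t : ℝ}
    (ht : 0 ≤ t) : 0 ≤ f t - l * (t - 1) := by
  have h := hf.lower t ht
  have h1 : 0 < max t 1 := lt_max_of_lt_right one_pos
  have h2 : 0 ≤ c * (t - 1) ^ 2 := mul_nonneg hf.pos.le (sq_nonneg _)
  exact nonneg_of_mul_nonneg_right (h2.trans h) h1

lemma comparableChiSq_chiSqFun : ComparableChiSq chiSqFun 1 0 where
  measurable := by unfold chiSqFun; fun_prop
  tendsto_zero := by
    have : Continuous chiSqFun := by unfold chiSqFun; fun_prop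
    exact this.continuousAt.tendsto.mono_left nhdsWithin_le_nhds
  pos := one_pos
  lower t ht := by
    simp only [chiSqFun, zero_mul, sub_zero]
    exact mul_le_mul_of_nonneg_right (le_max_right _ _) (sq_nonneg _)
  upper t ht := by
    simp only [chiSqFun, zero_mul, sub_zero]
    exact mul_le_mul_of_nonneg_right (min_le_right _ _) (sq_nonneg _)

/-! ### The generators `k_α` and `s_α` -/

section Generators

variable {α : ℝ}

lemma skew_pos (hα : α ∈ Ioc (0 : ℝ) 1) {t : ℝ} (ht : 0 ≤ t) : 0 < α + (1 - α) * t := by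
  have := mul_nonneg (sub_nonneg.2 hα.2) ht
  linarith [hα.1]

lemma skew_le_max (hα : α ∈ Ioc (0 : ℝ) 1) (t : ℝ) : α + (1 - α) * t ≤ max t 1 := by
  nlinarith [mul_le_mul_of_nonneg_left (le_max_left t 1) (sub_nonneg.2 hα.2),
    mul_le_mul_of_nonneg_left (le_max_right t 1) hα.1.le]

lemma min_le_skew (hα : α ∈ Ioc (0 : ℝ) 1) (t : ℝ) : min t 1 ≤ α + (1 - α) * t := by
  nlinarith [mul_le_mul_of_nonneg_left (min_le_left t 1) (sub_nonneg.2 hα.2),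
    mul_le_mul_of_nonneg_left (min_le_right t 1) hα.1.le]

/-- The line `α (t - 1)` is the tangent of `k_α` at `1`, and it equals `t - m` for the skewed
density `m = α + (1 - α) t`. -/
lemma kFun_sub_eq (hα : α ∈ Ioc (0 : ℝ) 1) {t : ℝ} (ht : 0 ≤ t) :
    kFun α t - α * (t - 1) = klPersp t (α + (1 - α) * t) := by
  rw [klPersp_eq (skew_pos hα ht), kFun]
  ring

lemma sFun_sub_eq (hα : α ∈ Ioc (0 : ℝ) 1) {t : ℝ} (ht : 0 ≤ t) :
    sFun α t - (2 * α - 1) * (t - 1) =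
      α * klPersp t (α + (1 - α) * t) + (1 - α) * klPersp 1 (α + (1 - α) * t) := by
  rw [klPersp_eq (skew_pos hα ht), klPersp_eq (skew_pos hα ht), sFun, Real.log_one]
  ring

lemma continuousAt_kFun_zero (hα : α ∈ Ioc (0 : ℝ) 1) : ContinuousAt (kFun α) 0 := by
  unfold kFun
  refine Real.continuous_mul_log.continuousAt.sub (continuousAt_id.mul ?_)
  refine ContinuousAt.log (by fun_prop) ?_
  simpa using hα.1.ne'

lemma continuousAt_sFun_zero (hα : α ∈ Ioc (0 : ℝ) 1) : ContinuousAt (sFun α) 0 := by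
  unfold sFun
  have h : Continuous fun t : ℝ => α * t * Real.log t := by
    simp_rw [mul_assoc]
    exact Real.continuous_mul_log.const_mul α
  refine h.continuousAt.sub (ContinuousAt.mul (by fun_prop) ?_)
  refine ContinuousAt.log (by fun_prop) ?_
  simpa using hα.1.ne'

/-- Here `t - m = α (t - 1)` produces the factor `α²`, and the mixture `m` never exceeds `max t 1`.
-/
lemma klPersp_skew_lower (hα : α ∈ Ioc (0 : ℝ) 1) {t : ℝ} (ht : 0 ≤ t) :
    α ^ 2 / 2 * (t - 1) ^ 2 ≤ max t 1 * klPersp t (α + (1 - α) * t) := by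
  have hm := skew_pos hα ht
  have h := sq_le_max_mul_klPersp ht hm
  have h2 := mul_le_mul_of_nonneg_right (max_le (le_max_left t 1) (skew_le_max hα t))
    (klPersp_nonneg ht hm)
  have e : (t - (α + (1 - α) * t)) ^ 2 = α ^ 2 * (t - 1) ^ 2 := by ring
  linarith

lemma klPersp_one_skew_lower (hα : α ∈ Ioc (0 : ℝ) 1) {t : ℝ} (ht : 0 ≤ t) :
    (1 - α) ^ 2 / 2 * (t - 1) ^ 2 ≤ max t 1 * klPersp 1 (α + (1 - α) * t) := by
  have hm := skew_pos hα ht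
  have h := sq_le_max_mul_klPersp zero_le_one hm
  have h2 := mul_le_mul_of_nonneg_right (max_le (le_max_right t 1) (skew_le_max hα t))
    (klPersp_nonneg zero_le_one hm)
  have e : (1 - (α + (1 - α) * t)) ^ 2 = (1 - α) ^ 2 * (t - 1) ^ 2 := by ring
  linarith

lemma klPersp_skew_upper (hα : α ∈ Ioc (0 : ℝ) 1) {t : ℝ} (ht : 0 ≤ t) :
    min t 1 * klPersp t (α + (1 - α) * t) ≤ α ^ 2 / 2 * (t - 1) ^ 2 := by
  have hm := skew_pos hα ht
  have h := min_mul_klPersp_le_sq ht hm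
  have h2 := mul_le_mul_of_nonneg_right (le_min (min_le_left t 1) (min_le_skew hα t))
    (klPersp_nonneg ht hm)
  have e : (t - (α + (1 - α) * t)) ^ 2 = α ^ 2 * (t - 1) ^ 2 := by ring
  linarith

lemma klPersp_one_skew_upper (hα : α ∈ Ioc (0 : ℝ) 1) {t : ℝ} (ht : 0 ≤ t) :
    min t 1 * klPersp 1 (α + (1 - α) * t) ≤ (1 - α) ^ 2 / 2 * (t - 1) ^ 2 := by
  have hm := skew_pos hα ht
  have h := min_mul_klPersp_le_sq zero_le_one hm
  have h2 := mul_le_mul_of_nonneg_right (le_min (min_le_right t 1) (min_le_skew hα t))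
    (klPersp_nonneg zero_le_one hm)
  have e : (1 - (α + (1 - α) * t)) ^ 2 = (1 - α) ^ 2 * (t - 1) ^ 2 := by ring
  linarith

lemma comparableChiSq_kFun (hα : α ∈ Ioc (0 : ℝ) 1) : ComparableChiSq (kFun α) (α ^ 2 / 2) α where
  measurable := by unfold kFun; fun_prop
  tendsto_zero := (continuousAt_kFun_zero hα).tendsto.mono_left nhdsWithin_le_nhds
  pos := by have := hα.1; positivity
  lower t ht := by
    rw [kFun_sub_eq hα ht]
    exact klPersp_skew_lower hα ht
  upper t ht := by
    rw [kFun_sub_eq hα ht]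
    exact klPersp_skew_upper hα ht

lemma comparableChiSq_sFun (hα : α ∈ Ioc (0 : ℝ) 1) :
    ComparableChiSq (sFun α) ((1 - 3 * α + 3 * α ^ 2) / 2) (2 * α - 1) where
  measurable := by unfold sFun; fun_prop
  tendsto_zero := (continuousAt_sFun_zero hα).tendsto.mono_left nhdsWithin_le_nhds
  pos := by nlinarith [sq_nonneg (2 * α - 1)]
  lower t ht := by
    rw [sFun_sub_eq hα ht]
    linarith [mul_le_mul_of_nonneg_left (klPersp_skew_lower hα ht) hα.1.le,
      mul_le_mul_of_nonneg_left (klPersp_one_skew_lower hα ht) (sub_nonneg.2 hα.2)]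
  upper t ht := by
    rw [sFun_sub_eq hα ht]
    linarith [mul_le_mul_of_nonneg_left (klPersp_skew_upper hα ht) hα.1.le,
      mul_le_mul_of_nonneg_left (klPersp_one_skew_upper hα ht) (sub_nonneg.2 hα.2)]

/-- Applying `log x ≤ x - 1` to `t / m` bounds the left side by `α² (t - 1)² / m`, and `m ≥ α`.
Equality holds at `t = 0`. -/
lemma kFun_sub_le (hα : α ∈ Ioc (0 : ℝ) 1) {t : ℝ} (ht : 0 ≤ t) :
    kFun α t - α * (t - 1) ≤ α * (t - 1) ^ 2 := by
  rcases ht.eq_or_lt with rfl | ht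
  · simp [kFun]
  have hm := skew_pos hα ht.le
  have hmα : α ≤ α + (1 - α) * t := by
    linarith [mul_nonneg (sub_nonneg.2 hα.2) ht.le]
  have hlog : Real.log t - Real.log (α + (1 - α) * t) ≤ t / (α + (1 - α) * t) - 1 := by
    rw [← Real.log_div ht.ne' hm.ne']
    exact Real.log_le_sub_one_of_pos (div_pos ht hm)
  have h1 := mul_le_mul_of_nonneg_left hlog ht.le
  have h2 : t * (t / (α + (1 - α) * t) - 1) - α * (t - 1)
      = α * (t - 1) ^ 2 * (α / (α + (1 - α) * t)) := by
    obtain ⟨m, hm_eq⟩ : ∃ m, m = α + (1 - α) * t := ⟨_, rfl⟩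
    rw [← hm_eq] at hm ⊢
    field_simp
    rw [hm_eq]
    ring
  have h3 : α * (t - 1) ^ 2 * (α / (α + (1 - α) * t)) ≤ α * (t - 1) ^ 2 :=
    mul_le_of_le_one_right (mul_nonneg hα.1.le (sq_nonneg _)) ((div_le_one hm).2 hmα)
  rw [kFun]
  linarith

/-- The first perspective contributes `α²`. The second is `m - 1 - log m` with `m ≥ α`, whose ratio
to `(m - 1)²` is largest at `m = α`; it contributes `(1 - α) (α - 1 - log α)`. The sum is the stated
constant. -/
lemma sFun_sub_le (hα : α ∈ Ioc (0 : ℝ) 1) {t : ℝ} (ht : 0 ≤ t) :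
    sFun α t - (2 * α - 1) * (t - 1) ≤
      ((1 - α) * Real.log (1 / α) + 2 * α - 1) * (t - 1) ^ 2 := by
  have hm := skew_pos hα ht
  have hk := kFun_sub_le hα ht
  rw [kFun_sub_eq hα ht] at hk
  have h1 : (1 - α) * klPersp 1 (α + (1 - α) * t) ≤
      (1 - α) * ((α - 1 - Real.log α) * (t - 1) ^ 2) := by
    rcases hα.2.eq_or_lt with rfl | hα1
    · simp
    refine mul_le_mul_of_nonneg_left ?_ (sub_nonneg.2 hα.2)
    have h := sub_one_sub_log_le (x := α + (1 - α) * t) hα.1 hα.2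
      (by linarith [mul_nonneg (sub_nonneg.2 hα.2) ht])
    have e : (α + (1 - α) * t - 1) ^ 2 = (1 - α) ^ 2 * (t - 1) ^ 2 := by ring
    rw [e] at h
    have hp : 0 < (1 - α) ^ 2 := by have := sub_pos.2 hα1; positivity
    refine le_of_mul_le_mul_left ?_ hp
    rw [klPersp_eq hm, Real.log_one]
    linarith
  rw [sFun_sub_eq hα ht, one_div, Real.log_inv]
  linarith [mul_le_mul_of_nonneg_left hk hα.1.le]

/-- A lower bound of `f` up to linear terms that integrates to Pinsker's inequality. -/
def PinskerBound (f : ℝ → ℝ) (c l : ℝ) : Prop :=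
  ∀ r : ℝ, ∃ w : ℝ, ∀ t, 0 ≤ t →
    c * (6 * r * |t - 1| - 9 * r ^ 2) - w * (t - 1) ≤ f t - l * (t - 1)

/-- Since `|t - m| = α |t - 1|`, the tangent parameter is taken as `α r`. The weight `t + 2 m` is
`3` plus a multiple of `t - 1`, and that multiple disappears on integration. -/
lemma klPersp_skew_pinsker (hα : α ∈ Ioc (0 : ℝ) 1) {t : ℝ} (ht : 0 ≤ t) (r : ℝ) :
    3 * α ^ 2 * (2 * r * |t - 1| - r ^ 2 * (3 + (3 - 2 * α) * (t - 1))) ≤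
      2 * klPersp t (α + (1 - α) * t) := by
  have h := pinsker_tangent_klPersp ht (skew_pos hα ht) (α * r)
  have e : |t - (α + (1 - α) * t)| = α * |t - 1| := by
    rw [show t - (α + (1 - α) * t) = α * (t - 1) by ring, abs_mul, abs_of_pos hα.1]
  rw [e] at h
  linarith

lemma klPersp_one_skew_pinsker (hα : α ∈ Ioc (0 : ℝ) 1) {t : ℝ} (ht : 0 ≤ t) (r : ℝ) :
    3 * (1 - α) ^ 2 * (2 * r * |t - 1| - r ^ 2 * (3 + 2 * (1 - α) * (t - 1))) ≤
      2 * klPersp 1 (α + (1 - α) * t) := by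
  have h := pinsker_tangent_klPersp zero_le_one (skew_pos hα ht) ((1 - α) * r)
  have e : |1 - (α + (1 - α) * t)| = (1 - α) * |t - 1| := by
    rw [show 1 - (α + (1 - α) * t) = -((1 - α) * (t - 1)) by ring, abs_neg, abs_mul,
      abs_of_nonneg (sub_nonneg.2 hα.2)]
  rw [e] at h
  linarith

lemma pinskerBound_kFun (hα : α ∈ Ioc (0 : ℝ) 1) : PinskerBound (kFun α) (α ^ 2 / 2) α := by
  intro r
  refine ⟨3 * α ^ 2 * r ^ 2 * (3 - 2 * α) / 2, fun t ht => ?_⟩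
  rw [kFun_sub_eq hα ht]
  linarith [klPersp_skew_pinsker hα ht r]

lemma pinskerBound_sFun (hα : α ∈ Ioc (0 : ℝ) 1) :
    PinskerBound (sFun α) ((1 - 3 * α + 3 * α ^ 2) / 2) (2 * α - 1) := by
  intro r
  refine ⟨α * (3 * α ^ 2 * r ^ 2 * (3 - 2 * α) / 2) +
    (1 - α) * (3 * (1 - α) ^ 2 * r ^ 2 * (2 * (1 - α)) / 2), fun t ht => ?_⟩
  rw [sFun_sub_eq hα ht]
  linarith [mul_le_mul_of_nonneg_left (klPersp_skew_pinsker hα ht r) hα.1.le,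
      mul_le_mul_of_nonneg_left (klPersp_one_skew_pinsker hα ht r) (sub_nonneg.2 hα.2)]

end Generators

/-! ### Divergences as integrals of a density -/

/-- The identity `x = (x - y) + y` in terms of positive and negative parts, arranged without
subtraction so that it can be integrated in `ENNReal`. -/
lemma ofReal_add_parts {x y : ℝ} (h : 0 ≤ x - y) :
    ENNReal.ofReal x + ENNReal.ofReal (-y) =
      ENNReal.ofReal (x - y) + ENNReal.ofReal (-x) + ENNReal.ofReal y := by
  rcases le_total 0 x with hx | hx <;> rcases le_total 0 y with hy | hy
  · rw [ENNReal.ofReal_of_nonpos (neg_nonpos.2 hx), ENNReal.ofReal_of_nonpos (neg_nonpos.2 hy),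
      add_zero, add_zero, ← ENNReal.ofReal_add h hy, sub_add_cancel]
  · rw [ENNReal.ofReal_of_nonpos (neg_nonpos.2 hx), ENNReal.ofReal_of_nonpos hy,
      add_zero, add_zero, ← ENNReal.ofReal_add hx (neg_nonneg.2 hy), sub_eq_add_neg]
  · have hx0 : x = 0 := by linarith
    have hy0 : y = 0 := by linarith
    simp [hx0, hy0]
  · rw [ENNReal.ofReal_of_nonpos hx, ENNReal.ofReal_of_nonpos hy, zero_add, add_zero,
      ← ENNReal.ofReal_add h (neg_nonneg.2 hx)]
    congr 1
    ring

section Bridge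

variable {Z : Type*} [MeasurableSpace Z]

lemma divIntegrand_of_ne_zero {f : ℝ → ℝ} (hf : Tendsto f (𝓝[>] 0) (𝓝 (f 0))) {p q : ℝ}
    (hq : q ≠ 0) : divIntegrand f p q = ((q * f (p / q) : ℝ) : EReal) := by
  rw [divIntegrand, if_neg hq]
  split_ifs with hp
  · have h : Tendsto (fun t : ℝ => (f t : EReal)) (𝓝[>] 0) (𝓝 (f 0 : EReal)) :=
      (continuous_coe_real_ereal.tendsto _).comp hf
    rw [h.limUnder_eq, hp, zero_div, EReal.coe_mul]
  · rfl

lemma divIntegrand_zero_right {f : ℝ → ℝ} (hf : Tendsto (fun u => f u / u) atTop atTop) {p : ℝ}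
    (hp : 0 < p) : divIntegrand f p 0 = ⊤ := by
  rw [divIntegrand, if_pos rfl, if_neg hp.ne', (EReal.tendsto_coe_nhds_top_iff.2 hf).limUnder_eq,
    EReal.coe_mul_top_of_pos hp]

/-- `g` is a finite nonnegative density of `P` with respect to `Q`. -/
structure IsRealDensity (P Q : Measure Z) (g : Z → ℝ) : Prop where
  measurable : Measurable g
  nonneg : ∀ z, 0 ≤ g z
  eq_withDensity : P = Q.withDensity fun z => ENNReal.ofReal (g z)

lemma exists_isRealDensity {P Q : Measure Z} [IsProbabilityMeasure P] [IsProbabilityMeasure Q]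
    (h : P ≪ Q) : ∃ g, IsRealDensity P Q g := by
  refine ⟨fun z => (P.rnDeriv Q z).toReal, (Measure.measurable_rnDeriv P Q).ennreal_toReal,
    fun z => ENNReal.toReal_nonneg, ?_⟩
  conv_lhs => rw [← Measure.withDensity_rnDeriv_eq P Q h]
  refine withDensity_congr_ae ?_
  filter_upwards [Measure.rnDeriv_lt_top P Q] with z hz
  rw [ENNReal.ofReal_toReal hz.ne]

namespace IsRealDensity

variable {P Q : Measure Z} {g : Z → ℝ}

lemma absolutelyContinuous (hg : IsRealDensity P Q g) : P ≪ Q := by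
  rw [hg.eq_withDensity]
  exact withDensity_absolutelyContinuous _ _

lemma lintegral_eq_one [IsProbabilityMeasure P] (hg : IsRealDensity P Q g) :
    ∫⁻ z, ENNReal.ofReal (g z) ∂Q = 1 := by
  have h : P univ = 1 := measure_univ
  rwa [hg.eq_withDensity, withDensity_apply _ MeasurableSet.univ, Measure.restrict_univ] at h

lemma integrable [IsProbabilityMeasure P] (hg : IsRealDensity P Q g) : Integrable g Q := by
  rw [← lintegral_ofReal_ne_top_iff_integrable hg.measurable.aestronglyMeasurable
    (ae_of_all _ hg.nonneg), hg.lintegral_eq_one]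
  exact ENNReal.one_ne_top

lemma integral_eq_one [IsProbabilityMeasure P] (hg : IsRealDensity P Q g) : ∫ z, g z ∂Q = 1 := by
  rw [integral_eq_lintegral_of_nonneg_ae (ae_of_all _ hg.nonneg)
    hg.measurable.aestronglyMeasurable, hg.lintegral_eq_one, ENNReal.toReal_one]

variable [IsProbabilityMeasure P] [IsProbabilityMeasure Q]

lemma integrable_linear (hg : IsRealDensity P Q g) (l : ℝ) :
    Integrable (fun z => l * (g z - 1)) Q :=
  (hg.integrable.sub (integrable_const 1)).const_mul l

lemma integral_linear (hg : IsRealDensity P Q g) (l : ℝ) : ∫ z, l * (g z - 1) ∂Q = 0 := by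
  rw [integral_const_mul, integral_sub hg.integrable (integrable_const 1), hg.integral_eq_one]
  simp

/-- Change of base from `P + Q` to `Q`: under `P ≪ Q` the two have the same null sets, so the
convention for `q = 0` plays no role. -/
lemma erealIntegral_divIntegrand (hg : IsRealDensity P Q g) {f : ℝ → ℝ}
    (hfm : Measurable f) (hf : Tendsto f (𝓝[>] 0) (𝓝 (f 0))) :
    fDiv f P Q = ((∫⁻ z, ENNReal.ofReal (f (g z)) ∂Q : ENNReal) : EReal) -
      ((∫⁻ z, ENNReal.ofReal (-f (g z)) ∂Q : ENNReal) : EReal) := by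
  have hQ : Q ≪ P + Q := (Measure.le_add_left le_rfl : Q ≤ P + Q).absolutelyContinuous
  have hμ : P + Q ≪ Q := hg.absolutelyContinuous.add_left Measure.AbsolutelyContinuous.rfl
  have hP : P.rnDeriv Q =ᵐ[P + Q] fun z => ENNReal.ofReal (g z) := by
    refine hμ.ae_le ?_
    conv in P.rnDeriv Q => rw [hg.eq_withDensity]
    exact Measure.rnDeriv_withDensity Q hg.measurable.ennreal_ofReal
  have hpos : ∀ᵐ z ∂(P + Q), 0 < Q.rnDeriv (P + Q) z := hμ.ae_le (Measure.rnDeriv_pos hQ)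
  have key : ∀ᵐ z ∂(P + Q), divIntegrand f (P.rnDeriv (P + Q) z).toReal
      (Q.rnDeriv (P + Q) z).toReal = (((Q.rnDeriv (P + Q) z).toReal * f (g z) : ℝ) : EReal) := by
    filter_upwards [hP, hpos, Measure.rnDeriv_lt_top Q (P + Q),
      Measure.rnDeriv_mul_rnDeriv (κ := P + Q) hg.absolutelyContinuous] with z h1 h2 h3 h4
    have hq : (Q.rnDeriv (P + Q) z).toReal ≠ 0 := (ENNReal.toReal_pos h2.ne' h3.ne).ne'
    rw [divIntegrand_of_ne_zero hf hq, ← h4, Pi.mul_apply, h1, ENNReal.toReal_mul,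
      ENNReal.toReal_ofReal (hg.nonneg z), mul_div_cancel_right₀ _ hq]
  have hlin : ∀ F : ℝ → ℝ, Measurable F →
      ∫⁻ z, ENNReal.ofReal ((Q.rnDeriv (P + Q) z).toReal * F (g z)) ∂(P + Q) =
        ∫⁻ z, ENNReal.ofReal (F (g z)) ∂Q := by
    intro F hF
    have hm : Measurable fun z => ENNReal.ofReal (F (g z)) :=
      (hF.comp hg.measurable).ennreal_ofReal
    rw [← lintegral_rnDeriv_mul hQ hm.aemeasurable]
    refine lintegral_congr_ae ?_
    filter_upwards [Measure.rnDeriv_lt_top Q (P + Q)] with z hz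
    rw [ENNReal.ofReal_mul ENNReal.toReal_nonneg, ENNReal.ofReal_toReal hz.ne]
  rw [fDiv, fDivWrt, erealIntegral]
  congr 2
  · rw [← hlin f hfm]
    refine lintegral_congr_ae ?_
    filter_upwards [key] with z hz
    rw [hz, EReal.real_coe_toENNReal]
  · rw [← hlin (fun t => -f t) hfm.neg]
    refine lintegral_congr_ae ?_
    filter_upwards [key] with z hz
    rw [hz, ← EReal.coe_neg, EReal.real_coe_toENNReal, mul_neg]

/-- The `f`-divergence as a Lebesgue integral of a nonnegative function of the density. -/
lemma fDiv_eq (hg : IsRealDensity P Q g) {f : ℝ → ℝ} {c l : ℝ} (hf : ComparableChiSq f c l) :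
    fDiv f P Q = ((∫⁻ z, ENNReal.ofReal (f (g z) - l * (g z - 1)) ∂Q : ENNReal) : EReal) := by
  rw [hg.erealIntegral_divIntegrand hf.measurable hf.tendsto_zero]
  have hfg : Measurable fun z => f (g z) := hf.measurable.comp hg.measurable
  have hgm := hg.measurable
  have hfn : Measurable fun z => ENNReal.ofReal (-f (g z)) := hfg.neg.ennreal_ofReal
  have hlm : Measurable fun z => l * (g z - 1) := by fun_prop
  have hL := hg.integrable_linear l
  have hLtop : ∫⁻ z, ENNReal.ofReal (l * (g z - 1)) ∂Q ≠ ⊤ := hL.lintegral_lt_top.ne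
  have hLntop : ∫⁻ z, ENNReal.ofReal (-(l * (g z - 1))) ∂Q ≠ ⊤ := hL.neg.lintegral_lt_top.ne
  -- The linear term has integral zero, so its positive and negative parts have equal mass.
  have hLeq : ∫⁻ z, ENNReal.ofReal (-(l * (g z - 1))) ∂Q =
      ∫⁻ z, ENNReal.ofReal (l * (g z - 1)) ∂Q := by
    have h := integral_eq_lintegral_pos_part_sub_lintegral_neg_part hL
    rw [hg.integral_linear l] at h
    exact ((ENNReal.toReal_eq_toReal_iff' hLtop hLntop).1 (by linarith)).symm
  -- Finite because `f` lies above the line `l (t - 1)`; this lets the negative part cancel in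
  -- `EReal`.
  have hntop : ∫⁻ z, ENNReal.ofReal (-f (g z)) ∂Q ≠ ⊤ := by
    refine ne_top_of_le_ne_top hLntop (lintegral_mono fun z => ENNReal.ofReal_le_ofReal ?_)
    linarith [hf.nonneg (hg.nonneg z)]
  have hsum : ∫⁻ z, ENNReal.ofReal (f (g z)) ∂Q =
      ∫⁻ z, ENNReal.ofReal (f (g z) - l * (g z - 1)) ∂Q + ∫⁻ z, ENNReal.ofReal (-f (g z)) ∂Q := by
    have h : ∫⁻ z, (ENNReal.ofReal (f (g z)) + ENNReal.ofReal (-(l * (g z - 1)))) ∂Q =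
        ∫⁻ z, (ENNReal.ofReal (f (g z) - l * (g z - 1)) + ENNReal.ofReal (-f (g z)) +
          ENNReal.ofReal (l * (g z - 1))) ∂Q :=
      lintegral_congr fun z => ofReal_add_parts (hf.nonneg (hg.nonneg z))
    rw [lintegral_add_left hfg.ennreal_ofReal, lintegral_add_right _ hlm.ennreal_ofReal,
      lintegral_add_right _ hfn, hLeq] at h
    exact (ENNReal.add_left_inj hLtop).1 h
  rw [hsum, EReal.coe_ennreal_add, ← EReal.coe_ennreal_toReal hntop, EReal.add_sub_cancel_right]

end IsRealDensity

/-- If `f` grows superlinearly, a finite `f`-divergence forces absolute continuity. -/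
lemma absolutelyContinuous_of_fDiv_lt_top {P Q : Measure Z} [IsProbabilityMeasure P]
    [IsProbabilityMeasure Q] {f : ℝ → ℝ} {c l : ℝ} (hf : ComparableChiSq f c l)
    (hsup : Tendsto (fun u => f u / u) atTop atTop) (h : fDiv f P Q < ⊤) : P ≪ Q := by
  refine Measure.AbsolutelyContinuous.mk fun s hs hQs => ?_
  by_contra hPs
  refine h.ne ?_
  have hQ : Q ≪ P + Q := (Measure.le_add_left le_rfl : Q ≤ P + Q).absolutelyContinuous
  have hP : P ≪ P + Q := (Measure.le_add_right le_rfl : P ≤ P + Q).absolutelyContinuous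
  have hpm := Measure.measurable_rnDeriv P (P + Q)
  have hqm := Measure.measurable_rnDeriv Q (P + Q)
  -- On the `Q`-null set `s` the density of `Q` vanishes, so the integrand is `⊤` wherever that of
  -- `P` does not, which has positive mass.
  have hpos : ∫⁻ z, (divIntegrand f (P.rnDeriv (P + Q) z).toReal
      (Q.rnDeriv (P + Q) z).toReal).toENNReal ∂(P + Q) = ⊤ := by
    rw [eq_top_iff]
    have h0 : ∀ᵐ z ∂((P + Q).restrict s), Q.rnDeriv (P + Q) z = 0 := by
      have := Measure.setLIntegral_rnDeriv hQ s
      rw [hQs, lintegral_eq_zero_iff hqm] at this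
      exact this
    calc (⊤ : ENNReal) = ∫⁻ z in s, ⊤ * P.rnDeriv (P + Q) z ∂(P + Q) := by
          rw [lintegral_const_mul _ hpm, Measure.setLIntegral_rnDeriv hP s, ENNReal.top_mul hPs]
      _ ≤ ∫⁻ z in s, (divIntegrand f (P.rnDeriv (P + Q) z).toReal
            (Q.rnDeriv (P + Q) z).toReal).toENNReal ∂(P + Q) := by
          refine lintegral_mono_ae ?_
          filter_upwards [h0, ae_restrict_of_ae (Measure.rnDeriv_lt_top P (P + Q))] with z h1 h2
          rw [h1, ENNReal.toReal_zero]
          rcases eq_or_ne (P.rnDeriv (P + Q) z) 0 with h3 | h3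
          · simp [h3]
          · rw [divIntegrand_zero_right hsup (ENNReal.toReal_pos h3 h2.ne), EReal.toENNReal_top]
            exact le_top
      _ ≤ _ := setLIntegral_le_lintegral _ _
  -- A finite negative part is essential, since `⊤ - ⊤ = ⊥` in `EReal`.
  have hneg : ∫⁻ z, (-divIntegrand f (P.rnDeriv (P + Q) z).toReal
      (Q.rnDeriv (P + Q) z).toReal).toENNReal ∂(P + Q) ≠ ⊤ := by
    have hb : ∀ z, (-divIntegrand f (P.rnDeriv (P + Q) z).toReal
        (Q.rnDeriv (P + Q) z).toReal).toENNReal ≤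
        ENNReal.ofReal |l| * (P.rnDeriv (P + Q) z + Q.rnDeriv (P + Q) z) := by
      intro z
      set p := (P.rnDeriv (P + Q) z).toReal with hp
      set q := (Q.rnDeriv (P + Q) z).toReal with hq
      have hp0 : 0 ≤ p := ENNReal.toReal_nonneg
      have hq0 : 0 ≤ q := ENNReal.toReal_nonneg
      rcases hq0.eq_or_lt with h1 | h1
      · rw [← h1]
        rcases hp0.eq_or_lt with h2 | h2
        · simp [← h2, divIntegrand]
        · rw [divIntegrand_zero_right hsup h2]
          simp
      · rw [divIntegrand_of_ne_zero hf.tendsto_zero h1.ne', ← EReal.coe_neg,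
          EReal.real_coe_toENNReal]
        have h3 : -(q * f (p / q)) ≤ |l| * (p + q) := by
          have h4 := mul_nonneg hq0 (hf.nonneg (div_nonneg hp0 hq0))
          have h5 : q * (f (p / q) - l * (p / q - 1)) = q * f (p / q) - l * (p - q) := by
            field_simp
          rw [h5] at h4
          have h6 : -(l * (p - q)) ≤ |l| * (p + q) := by
            rw [← neg_mul]
            refine (le_abs_self _).trans ?_
            rw [abs_mul, abs_neg]
            refine mul_le_mul_of_nonneg_left ?_ (abs_nonneg l)
            rw [abs_le]
            constructor <;> linarith
          linarith
        refine (ENNReal.ofReal_le_ofReal h3).trans ?_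
        rw [ENNReal.ofReal_mul (abs_nonneg l), ENNReal.ofReal_add hp0 hq0]
        gcongr
        · exact ENNReal.ofReal_toReal_le
        · exact ENNReal.ofReal_toReal_le
    refine ne_top_of_le_ne_top ?_ (lintegral_mono hb)
    rw [lintegral_const_mul' _ _ ENNReal.ofReal_ne_top, lintegral_add_left hpm]
    exact ENNReal.mul_ne_top ENNReal.ofReal_ne_top (ENNReal.add_ne_top.2
      ⟨(Measure.lintegral_rnDeriv_lt_top P _).ne, (Measure.lintegral_rnDeriv_lt_top Q _).ne⟩)
  rw [fDiv, fDivWrt, erealIntegral, hpos, ← EReal.coe_ennreal_toReal hneg, EReal.coe_ennreal_top,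
    EReal.top_sub_coe]

end Bridge

/-! ### Pinsker and reverse Pinsker inequalities -/

section Bounds

variable {Z : Type*} [MeasurableSpace Z] {P Q : Measure Z} {g : Z → ℝ}

lemma IsRealDensity.fDiv_chiSqFun_eq [IsProbabilityMeasure P] [IsProbabilityMeasure Q]
    (hg : IsRealDensity P Q g) :
    fDiv chiSqFun P Q = ((∫⁻ z, ENNReal.ofReal ((g z - 1) ^ 2) ∂Q : ENNReal) : EReal) := by
  rw [hg.fDiv_eq comparableChiSq_chiSqFun]
  simp [chiSqFun]

lemma IsRealDensity.lintegral_le_chiSq (hg : IsRealDensity P Q g) {f : ℝ → ℝ} {l A : ℝ}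
    (hA0 : 0 ≤ A) (hA : ∀ t, 0 ≤ t → f t - l * (t - 1) ≤ A * (t - 1) ^ 2) :
    ∫⁻ z, ENNReal.ofReal (f (g z) - l * (g z - 1)) ∂Q ≤
      ENNReal.ofReal A * ∫⁻ z, ENNReal.ofReal ((g z - 1) ^ 2) ∂Q := by
  rw [← lintegral_const_mul' _ _ ENNReal.ofReal_ne_top]
  refine lintegral_mono fun z => ?_
  rw [← ENNReal.ofReal_mul hA0]
  exact ENNReal.ofReal_le_ofReal (hA _ (hg.nonneg z))

lemma ofReal_integral_le_lintegral_ofReal {h : Z → ℝ} (hh : Integrable h Q) :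
    ENNReal.ofReal (∫ z, h z ∂Q) ≤ ∫⁻ z, ENNReal.ofReal (h z) ∂Q := by
  rw [integral_eq_lintegral_pos_part_sub_lintegral_neg_part hh]
  refine (ENNReal.ofReal_le_ofReal (sub_le_self _ ENNReal.toReal_nonneg)).trans ?_
  exact ENNReal.ofReal_toReal_le

/-- Pinsker's inequality for generators that satisfy a `PinskerBound`. -/
lemma IsRealDensity.pinsker [IsProbabilityMeasure P] [IsProbabilityMeasure Q]
    (hg : IsRealDensity P Q g) {f : ℝ → ℝ} {c l : ℝ} (hf : PinskerBound f c l) :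
    ENNReal.ofReal (c * (∫ z, |g z - 1| ∂Q) ^ 2) ≤
      ∫⁻ z, ENNReal.ofReal (f (g z) - l * (g z - 1)) ∂Q := by
  set N := ∫ z, |g z - 1| ∂Q with hN
  -- `r = N / 3` maximises `6 r N - 9 r²`, with value `N²`.
  obtain ⟨w, hw⟩ := hf (N / 3)
  have habs : Integrable (fun z => |g z - 1|) Q := (hg.integrable.sub (integrable_const 1)).abs
  have h1 : Integrable (fun z => c * (6 * (N / 3) * |g z - 1| - 9 * (N / 3) ^ 2)) Q :=
    ((habs.const_mul _).sub (integrable_const _)).const_mul c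
  have hint : ∫ z, (c * (6 * (N / 3) * |g z - 1| - 9 * (N / 3) ^ 2) - w * (g z - 1)) ∂Q =
      c * N ^ 2 := by
    rw [integral_sub h1 (hg.integrable_linear w), hg.integral_linear, integral_const_mul,
      integral_sub (habs.const_mul _) (integrable_const _), integral_const_mul, ← hN]
    simp only [integral_const, probReal_univ, smul_eq_mul, one_mul, sub_zero]
    ring
  rw [← hint]
  refine (ofReal_integral_le_lintegral_ofReal (h1.sub (hg.integrable_linear w))).trans ?_
  exact lintegral_mono fun z => ENNReal.ofReal_le_ofReal (hw _ (hg.nonneg z))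

/-- A deviation at an atom is at most half of the total deviation. -/
lemma IsRealDensity.abs_sub_one_mul_le [MeasurableSingletonClass Z]
    [IsProbabilityMeasure P] [IsProbabilityMeasure Q]
    (hg : IsRealDensity P Q g) (x : Z) :
    |g x - 1| * Q.real {x} ≤ (∫ z, |g z - 1| ∂Q) / 2 := by
  have hd : Integrable (fun z => g z - 1) Q := hg.integrable.sub (integrable_const 1)
  have hx : MeasurableSet ({x} : Set Z) := measurableSet_singleton x
  have h1 := integral_add_compl hx hd
  have h2 := integral_add_compl hx hd.abs
  have h0 : ∫ z, (g z - 1) ∂Q = 0 := by simpa using hg.integral_linear 1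
  rw [integral_singleton, h0, smul_eq_mul] at h1
  rw [integral_singleton, smul_eq_mul] at h2
  -- As `g - 1` has integral zero, the deviation at `x` is balanced by an opposite one on the
  -- complement.
  have h3 : |∫ z in {x}ᶜ, (g z - 1) ∂Q| ≤ ∫ z in {x}ᶜ, |g z - 1| ∂Q :=
    abs_integral_le_integral_abs
  have h4 : ∫ z in {x}ᶜ, (g z - 1) ∂Q = -(Q.real {x} * (g x - 1)) := by linarith
  rw [h4, abs_neg, abs_mul, abs_of_nonneg measureReal_nonneg] at h3
  linarith

lemma ae_singleton_pos {S : Finset Z} (hS : Q (S : Set Z)ᶜ = 0) : ∀ᵐ x ∂Q, 0 < Q {x} := by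
  have h1 : ∀ᵐ x ∂Q, x ∈ S := by
    rw [ae_iff]
    exact hS
  have h2 : Q {x | x ∈ S ∧ Q {x} = 0} = 0 := by
    have hc : {x | x ∈ S ∧ Q {x} = 0}.Countable :=
      (S.finite_toSet.subset fun x hx => hx.1).countable
    rw [← biUnion_of_singleton {x | x ∈ S ∧ Q {x} = 0}, measure_biUnion_null_iff hc]
    exact fun x hx => hx.2
  have h3 : ∀ᵐ x ∂Q, ¬(x ∈ S ∧ Q {x} = 0) := by
    rw [ae_iff]
    simpa using h2
  filter_upwards [h1, h3] with x hx1 hx3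
  exact pos_iff_ne_zero.2 fun h => hx3 ⟨hx1, h⟩

lemma minMass_le [IsProbabilityMeasure Q] {x : Z} (hx : 0 < Q {x}) : minMass Q ≤ Q.real {x} :=
  csInf_le ⟨0, fun _ hr => hr.1.le⟩ ⟨ENNReal.toReal_pos hx.ne' (measure_ne_top _ _), x, rfl⟩

lemma minMass_pos [IsProbabilityMeasure Q] {S : Finset Z} (hS : Q (S : Set Z)ᶜ = 0) :
    0 < minMass Q := by
  have hfin : {r : ℝ | 0 < r ∧ ∃ x : Z, Q.real {x} = r}.Finite := by
    refine (S.finite_toSet.image fun x => Q.real {x}).subset ?_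
    rintro r ⟨hr, x, rfl⟩
    refine ⟨x, ?_, rfl⟩
    by_contra hx
    have h : Q {x} = 0 := measure_mono_null (singleton_subset_iff.2 hx) hS
    rw [measureReal_def, h] at hr
    simp at hr
  have hne : {r : ℝ | 0 < r ∧ ∃ x : Z, Q.real {x} = r}.Nonempty := by
    obtain ⟨x, hx⟩ := (ae_singleton_pos hS).exists
    exact ⟨_, ENNReal.toReal_pos hx.ne' (measure_ne_top _ _), x, rfl⟩
  exact (hne.csInf_mem hfin).1

/-- A reverse Pinsker inequality for the chi-squared divergence. -/
lemma IsRealDensity.minMass_mul_chiSq_le [MeasurableSingletonClass Z]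
    [IsProbabilityMeasure P] [IsProbabilityMeasure Q]
    (hg : IsRealDensity P Q g) {S : Finset Z} (hS : Q (S : Set Z)ᶜ = 0) :
    ENNReal.ofReal (minMass Q) * ∫⁻ z, ENNReal.ofReal ((g z - 1) ^ 2) ∂Q ≤
      ENNReal.ofReal ((∫ z, |g z - 1| ∂Q) ^ 2 / 2) := by
  set N := ∫ z, |g z - 1| ∂Q with hN
  have hN0 : 0 ≤ N := integral_nonneg fun z => abs_nonneg _
  have hNl : ENNReal.ofReal N = ∫⁻ z, ENNReal.ofReal |g z - 1| ∂Q :=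
    ofReal_integral_eq_lintegral_ofReal (hg.integrable.sub (integrable_const 1)).abs
      (ae_of_all _ fun z => abs_nonneg _)
  rw [show N ^ 2 / 2 = N / 2 * N by ring, ENNReal.ofReal_mul (by positivity), hNl,
    ← lintegral_const_mul' _ _ ENNReal.ofReal_ne_top,
    ← lintegral_const_mul' _ _ ENNReal.ofReal_ne_top]
  refine lintegral_mono_ae ?_
  filter_upwards [ae_singleton_pos hS] with x hx
  rw [← ENNReal.ofReal_mul (minMass_pos hS).le, ← ENNReal.ofReal_mul (by positivity)]
  refine ENNReal.ofReal_le_ofReal ?_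
  have h1 := mul_le_mul_of_nonneg_left (minMass_le hx) (abs_nonneg (g x - 1))
  have h2 := mul_le_mul_of_nonneg_right (h1.trans (hg.abs_sub_one_mul_le x))
    (abs_nonneg (g x - 1))
  rw [← sq_abs (g x - 1)]
  linarith

end Bounds

/-! ### Comparison of contraction coefficients -/

section Contraction

variable {X Y : Type*} [MeasurableSpace X] [MeasurableSpace Y] {Q : Measure X}
  [IsProbabilityMeasure Q] {W : Kernel X Y} [IsMarkovKernel W]

theorem contractionCoeff_le_mul_chiSq [MeasurableSingletonClass X] {f : ℝ → ℝ} {c l A : ℝ}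
    (hf : ComparableChiSq f c l) (hp : PinskerBound f c l)
    (hA : ∀ t, 0 ≤ t → f t - l * (t - 1) ≤ A * (t - 1) ^ 2)
    {S : Finset X} (hS : Q (S : Set X)ᶜ = 0)
    (hac : ∀ P : Measure X, IsProbabilityMeasure P → fDiv f P Q < ⊤ → P ≪ Q) :
    contractionCoeff f Q W ≤
      ((A / (2 * c * minMass Q) : ℝ) : EReal) * contractionCoeff chiSqFun Q W := by
  refine iSup₂_le fun P ⟨hP, h0, htop⟩ => ?_
  have hPQ := hac P hP htop
  obtain ⟨g, hg⟩ := exists_isRealDensity hPQ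
  obtain ⟨h, hh⟩ := exists_isRealDensity (hPQ.comp_right W)
  have hm := minMass_pos hS
  have hc := hf.pos
  have hA0 : 0 ≤ A := by simpa using (hf.nonneg le_rfl).trans (hA 0 le_rfl)
  have hJ := hh.lintegral_le_chiSq hA0 hA
  have hI := hg.lintegral_le_chiSq hA0 hA
  have hle : ENNReal.ofReal (2 * c * minMass Q) * ∫⁻ z, ENNReal.ofReal ((g z - 1) ^ 2) ∂Q ≤
      ∫⁻ z, ENNReal.ofReal (f (g z) - l * (g z - 1)) ∂Q := by
    refine le_trans ?_ (hg.pinsker hp)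
    rw [ENNReal.ofReal_mul (by positivity), mul_assoc]
    refine (mul_le_mul_right (hg.minMass_mul_chiSq_le hS) _).trans ?_
    rw [← ENNReal.ofReal_mul (by positivity)]
    exact ENNReal.ofReal_le_ofReal (by linarith)
  have hM : fDiv chiSqFun P Q ≠ 0 → fDiv chiSqFun P Q ≠ ⊤ →
      fDiv chiSqFun (P.bind W) (Q.bind W) / fDiv chiSqFun P Q ≤ contractionCoeff chiSqFun Q W := by
    intro h1 h2
    refine le_iSup₂_of_le P ⟨hP, ?_, h2.lt_top⟩ le_rfl
    refine lt_of_le_of_ne ?_ h1.symm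
    rw [hg.fDiv_chiSqFun_eq]
    exact EReal.coe_ennreal_nonneg _
  rw [EReal.div_le_iff_le_mul h0 htop.ne]
  rw [hg.fDiv_eq hf] at h0 htop ⊢
  rw [hh.fDiv_eq hf]
  rw [hg.fDiv_chiSqFun_eq, hh.fDiv_chiSqFun_eq] at hM
  set I := ∫⁻ z, ENNReal.ofReal (f (g z) - l * (g z - 1)) ∂Q
  set J := ∫⁻ z, ENNReal.ofReal (f (h z) - l * (h z - 1)) ∂(Q.bind W)
  set a := ∫⁻ z, ENNReal.ofReal ((g z - 1) ^ 2) ∂Q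
  set b := ∫⁻ z, ENNReal.ofReal ((h z - 1) ^ 2) ∂(Q.bind W)
  have h0' : I ≠ 0 := by
    rintro hI0
    simp [hI0] at h0
  have htop' : I ≠ ⊤ := by
    rintro hI0
    simp [hI0] at htop
  have ha0 : a ≠ 0 := by
    intro ha
    rw [ha, mul_zero] at hI
    exact h0' (le_antisymm hI zero_le)
  have hC0 : ENNReal.ofReal (2 * c * minMass Q) ≠ 0 :=
    (ENNReal.ofReal_pos.2 (by positivity)).ne'
  have hatop : a ≠ ⊤ := by
    intro ha
    rw [ha, ENNReal.mul_top hC0] at hle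
    exact htop' (top_le_iff.1 hle)
  have hdiv := hM (by simpa using ha0) (by simpa using hatop)
  -- A supremum over no competitors would be `⊥`; here `P` itself is one, so the coefficient may be
  -- treated in `ENNReal`.
  have hM0 : 0 ≤ contractionCoeff chiSqFun Q W :=
    le_trans (EReal.div_nonneg (EReal.coe_ennreal_nonneg _) (EReal.coe_ennreal_nonneg _)) hdiv
  rw [EReal.div_le_iff_le_mul (by simpa [pos_iff_ne_zero] using ha0) (by simpa using hatop)] at hdiv
  obtain ⟨M, hM'⟩ : ∃ M : ENNReal, (M : EReal) = contractionCoeff chiSqFun Q W :=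
    ⟨_, EReal.coe_toENNReal hM0⟩
  have hC : ((A / (2 * c * minMass Q) : ℝ) : EReal) =
      ((ENNReal.ofReal (A / (2 * c * minMass Q)) : ENNReal) : EReal) := by
    rw [EReal.coe_ennreal_ofReal, max_eq_left (by positivity)]
  rw [← hM', ← EReal.coe_ennreal_mul, EReal.coe_ennreal_le_coe_ennreal_iff] at hdiv
  rw [← hM', hC, ← EReal.coe_ennreal_mul, ← EReal.coe_ennreal_mul,
    EReal.coe_ennreal_le_coe_ennreal_iff]
  calc J ≤ ENNReal.ofReal A * b := hJ
    _ ≤ ENNReal.ofReal A * (a * M) := by gcongr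
    _ = ENNReal.ofReal (A / (2 * c * minMass Q)) * (ENNReal.ofReal (2 * c * minMass Q) * a) * M := by
        rw [← mul_assoc (ENNReal.ofReal (A / _)), ← ENNReal.ofReal_mul (by positivity),
          div_mul_cancel₀ _ (by positivity), mul_assoc]
    _ ≤ ENNReal.ofReal (A / (2 * c * minMass Q)) * I * M := by gcongr
    _ = I * (ENNReal.ofReal (A / (2 * c * minMass Q)) * M) := by ring

/-- The mixture `(1 - ε) Q + ε P`. -/
noncomputable def mixture {Z : Type*} [MeasurableSpace Z] (ε : ℝ) (P Q : Measure Z) : Measure Z :=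
  ENNReal.ofReal (1 - ε) • Q + ENNReal.ofReal ε • P

lemma isProbabilityMeasure_mixture {Z : Type*} [MeasurableSpace Z] {P Q : Measure Z}
    [IsProbabilityMeasure P] [IsProbabilityMeasure Q] {ε : ℝ} (h0 : 0 < ε) (h1 : ε < 1) :
    IsProbabilityMeasure (mixture ε P Q) := by
  refine ⟨?_⟩
  simp only [mixture, Measure.add_apply, Measure.smul_apply, measure_univ, smul_eq_mul, mul_one]
  rw [← ENNReal.ofReal_add (by linarith) h0.le]
  simp

lemma mixture_bind {ε : ℝ} (P Q : Measure X) (W : Kernel X Y) :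
    (mixture ε P Q).bind W = mixture ε (P.bind W) (Q.bind W) := by
  rw [mixture, Measure.comp_add, Measure.comp_smul, Measure.comp_smul, mixture]

lemma IsRealDensity.mixture {Z : Type*} [MeasurableSpace Z] {P Q : Measure Z} {g : Z → ℝ}
    (hg : IsRealDensity P Q g) {ε : ℝ} (h0 : 0 < ε) (h1 : ε < 1) :
    IsRealDensity (mixture ε P Q) Q (fun z => 1 + ε * (g z - 1)) where
  measurable := by
    have := hg.measurable
    fun_prop
  nonneg z := by nlinarith [mul_nonneg h0.le (hg.nonneg z)]
  eq_withDensity := by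
    have h : (fun z => ENNReal.ofReal (1 + ε * (g z - 1))) =
        (fun _ => ENNReal.ofReal (1 - ε)) + ENNReal.ofReal ε • fun z => ENNReal.ofReal (g z) := by
      ext z
      rw [Pi.add_apply, Pi.smul_apply, smul_eq_mul, ← ENNReal.ofReal_mul h0.le,
        ← ENNReal.ofReal_add (by linarith) (mul_nonneg h0.le (hg.nonneg z))]
      congr 1
      ring
    rw [h, withDensity_add_left measurable_const, withDensity_const,
      withDensity_smul _ hg.measurable.ennreal_ofReal, ← hg.eq_withDensity, _root_.mixture]

section Mixture

variable {Z : Type*} [MeasurableSpace Z] {P Q : Measure Z} {g : Z → ℝ} {f : ℝ → ℝ} {c l ε : ℝ}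

/-- The mixed density is at least `1 - ε`, so `min t 1 ≥ 1 - ε` in the upper comparison. -/
lemma IsRealDensity.mixture_le (hg : IsRealDensity P Q g) (hf : ComparableChiSq f c l)
    (h0 : 0 < ε) (h1 : ε < 1) :
    ∫⁻ z, ENNReal.ofReal (f (1 + ε * (g z - 1)) - l * (1 + ε * (g z - 1) - 1)) ∂Q ≤
      ENNReal.ofReal (c * ε ^ 2) *
        (ENNReal.ofReal (1 - ε)⁻¹ * ∫⁻ z, ENNReal.ofReal ((g z - 1) ^ 2) ∂Q) := by
  have hc := hf.pos
  have he : 0 < 1 - ε := by linarith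
  rw [← lintegral_const_mul' _ _ ENNReal.ofReal_ne_top,
    ← lintegral_const_mul' _ _ ENNReal.ofReal_ne_top]
  refine lintegral_mono fun z => ?_
  rw [← ENNReal.ofReal_mul (by positivity), ← ENNReal.ofReal_mul (by positivity)]
  refine ENNReal.ofReal_le_ofReal ?_
  have ht := (hg.mixture h0 h1).nonneg z
  have h2 := hf.upper _ ht
  have h3 : 1 - ε ≤ min (1 + ε * (g z - 1)) 1 := by
    refine le_min ?_ (by linarith)
    nlinarith [mul_nonneg h0.le (hg.nonneg z)]
  have h4 := (mul_le_mul_of_nonneg_right h3 (hf.nonneg ht)).trans h2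
  rw [mul_comm, ← le_div_iff₀ he] at h4
  refine h4.trans (le_of_eq ?_)
  field_simp
  ring

/-- The factor `max t 1` stays under the integral because `g` may be unbounded; it is removed later
as `ε → 0`. -/
lemma IsRealDensity.le_mixture (hg : IsRealDensity P Q g) (hf : ComparableChiSq f c l)
    (h0 : 0 < ε) (h1 : ε < 1) :
    ENNReal.ofReal (c * ε ^ 2) *
        ∫⁻ z, ENNReal.ofReal ((g z - 1) ^ 2 / max (1 + ε * (g z - 1)) 1) ∂Q ≤
      ∫⁻ z, ENNReal.ofReal (f (1 + ε * (g z - 1)) - l * (1 + ε * (g z - 1) - 1)) ∂Q := by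
  have hc := hf.pos
  rw [← lintegral_const_mul' _ _ ENNReal.ofReal_ne_top]
  refine lintegral_mono fun z => ?_
  rw [← ENNReal.ofReal_mul (by positivity)]
  refine ENNReal.ofReal_le_ofReal ?_
  have h2 := hf.lower _ ((hg.mixture h0 h1).nonneg z)
  have hmax : 0 < max (1 + ε * (g z - 1)) 1 := lt_max_of_lt_right one_pos
  rw [← mul_div_assoc, div_le_iff₀ hmax]
  linarith

lemma IsRealDensity.mixture_ne_zero (hg : IsRealDensity P Q g) (hf : ComparableChiSq f c l)
    (h0 : 0 < ε) (h1 : ε < 1) (ha : ∫⁻ z, ENNReal.ofReal ((g z - 1) ^ 2) ∂Q ≠ 0) :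
    ∫⁻ z, ENNReal.ofReal (f (1 + ε * (g z - 1)) - l * (1 + ε * (g z - 1) - 1)) ∂Q ≠ 0 := by
  intro h
  have h2 := hg.le_mixture hf h0 h1
  have hc := hf.pos
  have hgm := hg.measurable
  rw [h, nonpos_iff_eq_zero, mul_eq_zero,
    or_iff_right (ENNReal.ofReal_pos.2 (by positivity)).ne', lintegral_eq_zero_iff (by fun_prop)] at h2
  apply ha
  rw [lintegral_eq_zero_iff (by fun_prop)]
  filter_upwards [h2] with z hz
  have hmax : 0 < max (1 + ε * (g z - 1)) 1 := lt_max_of_lt_right one_pos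
  rw [Pi.zero_apply, ENNReal.ofReal_eq_zero] at hz ⊢
  rw [div_le_iff₀ hmax, zero_mul] at hz
  exact hz

/-- Fatou's lemma along `ε → 0`; it needs no finiteness of the left side. -/
lemma lintegral_chiSq_le_of_forall_mixture (hg : Measurable g) {K : ENNReal}
    (h : ∀ ε : ℝ, 0 < ε → ε < 1 →
      ∫⁻ z, ENNReal.ofReal ((g z - 1) ^ 2 / max (1 + ε * (g z - 1)) 1) ∂Q ≤
        ENNReal.ofReal (1 - ε)⁻¹ * K) :
    ∫⁻ z, ENNReal.ofReal ((g z - 1) ^ 2) ∂Q ≤ K := by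
  -- `e n = 1 / (n + 2)`: the shift keeps it below `1` already at `n = 0`.
  set e : ℕ → ℝ := fun n => 1 / ((n + 1 : ℕ) + 1 : ℝ) with he
  have he0 : Tendsto e atTop (𝓝 0) :=
    (tendsto_one_div_add_atTop_nhds_zero_nat (𝕜 := ℝ)).comp (tendsto_add_atTop_nat 1)
  have hepos : ∀ n, 0 < e n := fun n => by positivity
  have helt : ∀ n, e n < 1 := fun n => by
    rw [he]
    simp only
    rw [div_lt_one (by positivity)]
    push_cast
    linarith [(Nat.cast_nonneg n : (0 : ℝ) ≤ n)]
  have hlim : ∀ z, Tendsto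
      (fun n => ENNReal.ofReal ((g z - 1) ^ 2 / max (1 + e n * (g z - 1)) 1)) atTop
      (𝓝 (ENNReal.ofReal ((g z - 1) ^ 2))) := by
    intro z
    refine ENNReal.tendsto_ofReal ?_
    have h1 : Tendsto (fun n => max (1 + e n * (g z - 1)) 1) atTop (𝓝 1) := by
      have := ((he0.mul_const (g z - 1)).const_add 1).max (tendsto_const_nhds (x := (1 : ℝ)))
      simpa using this
    have h2 := (tendsto_const_nhds (x := (g z - 1) ^ 2)).div h1 one_ne_zero
    rwa [div_one] at h2
  have hK : Tendsto (fun n => ENNReal.ofReal (1 - e n)⁻¹ * K) atTop (𝓝 K) := by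
    have h1 : Tendsto (fun n => ENNReal.ofReal (1 - e n)⁻¹) atTop (𝓝 1) := by
      rw [← ENNReal.ofReal_one]
      refine ENNReal.tendsto_ofReal ?_
      simpa using (he0.const_sub 1).inv₀ (by simp)
    simpa using ENNReal.Tendsto.mul_const (b := K) h1 (Or.inl one_ne_zero)
  calc ∫⁻ z, ENNReal.ofReal ((g z - 1) ^ 2) ∂Q
      = ∫⁻ z, liminf (fun n => ENNReal.ofReal
          ((g z - 1) ^ 2 / max (1 + e n * (g z - 1)) 1)) atTop ∂Q :=
        lintegral_congr fun z => (hlim z).liminf_eq.symm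
    _ ≤ liminf (fun n => ∫⁻ z, ENNReal.ofReal
          ((g z - 1) ^ 2 / max (1 + e n * (g z - 1)) 1) ∂Q) atTop :=
        lintegral_liminf_le fun n => by fun_prop
    _ ≤ liminf (fun n => ENNReal.ofReal (1 - e n)⁻¹ * K) atTop :=
        liminf_le_liminf (Eventually.of_forall fun n => h _ (hepos n) (helt n))
    _ = K := hK.liminf_eq

end Mixture

lemma tendsto_chiSqFun_div : Tendsto (fun u => chiSqFun u / u) atTop atTop := by
  refine tendsto_atTop_mono' _ ?_ (tendsto_atTop_add_const_right atTop (-2 : ℝ) tendsto_id)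
  filter_upwards [eventually_gt_atTop 0] with u hu
  rw [chiSqFun, le_div_iff₀ hu]
  simp only [id]
  nlinarith

theorem contractionCoeff_chiSq_le {f : ℝ → ℝ} {c l : ℝ} (hf : ComparableChiSq f c l) :
    contractionCoeff chiSqFun Q W ≤ contractionCoeff f Q W := by
  refine iSup₂_le fun P ⟨hP, h0, htop⟩ => ?_
  have hPQ := absolutelyContinuous_of_fDiv_lt_top comparableChiSq_chiSqFun
    tendsto_chiSqFun_div htop
  obtain ⟨g, hg⟩ := exists_isRealDensity hPQ
  obtain ⟨h, hh⟩ := exists_isRealDensity (hPQ.comp_right W)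
  rw [EReal.div_le_iff_le_mul h0 htop.ne]
  rw [hg.fDiv_chiSqFun_eq] at h0 htop ⊢
  rw [hh.fDiv_chiSqFun_eq]
  set a := ∫⁻ z, ENNReal.ofReal ((g z - 1) ^ 2) ∂Q with ha
  set b := ∫⁻ z, ENNReal.ofReal ((h z - 1) ^ 2) ∂(Q.bind W) with hb
  have ha0 : a ≠ 0 := by
    intro ha
    simp [ha] at h0
  have hatop : a ≠ ⊤ := by
    intro ha
    simp [ha] at htop
  have hc := hf.pos
  have key : ∀ ε : ℝ, 0 < ε → ε < 1 → 0 ≤ contractionCoeff f Q W ∧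
      ((∫⁻ z, ENNReal.ofReal (f (1 + ε * (h z - 1)) - l * (1 + ε * (h z - 1) - 1)) ∂(Q.bind W) :
        ENNReal) : EReal) ≤
      ((∫⁻ z, ENNReal.ofReal (f (1 + ε * (g z - 1)) - l * (1 + ε * (g z - 1) - 1)) ∂Q :
        ENNReal) : EReal) * contractionCoeff f Q W := by
    intro ε he0 he1
    have hmP := isProbabilityMeasure_mixture (P := P) (Q := Q) he0 he1
    have hmY := isProbabilityMeasure_mixture (P := P.bind W) (Q := Q.bind W) he0 he1
    have hgε := (hg.mixture he0 he1).fDiv_eq hf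
    have hhε := (hh.mixture he0 he1).fDiv_eq hf
    have hI0 := hg.mixture_ne_zero hf he0 he1 ha0
    have hItop := ne_top_of_le_ne_top
      (ENNReal.mul_ne_top ENNReal.ofReal_ne_top (ENNReal.mul_ne_top ENNReal.ofReal_ne_top hatop))
      (hg.mixture_le hf he0 he1)
    set I := ∫⁻ z, ENNReal.ofReal (f (1 + ε * (g z - 1)) - l * (1 + ε * (g z - 1) - 1)) ∂Q
    have hI0' : (0 : EReal) < (I : EReal) := by simpa [pos_iff_ne_zero] using hI0
    have hItop' : (I : EReal) ≠ ⊤ := by simpa using hItop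
    have hle : fDiv f ((mixture ε P Q).bind W) (Q.bind W) / fDiv f (mixture ε P Q) Q ≤
        contractionCoeff f Q W :=
      le_iSup₂_of_le (mixture ε P Q) ⟨hmP, by rwa [hgε], by rw [hgε]; exact hItop'.lt_top⟩ le_rfl
    rw [mixture_bind, hgε, hhε] at hle
    refine ⟨le_trans (EReal.div_nonneg (EReal.coe_ennreal_nonneg _)
      (EReal.coe_ennreal_nonneg _)) hle, ?_⟩
    rwa [EReal.div_le_iff_le_mul hI0' hItop'] at hle
  -- Any `ε` in `(0, 1)` gives a competitor, hence nonnegativity; `1 / 2` is arbitrary.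
  obtain ⟨M, hM⟩ : ∃ M : ENNReal, (M : EReal) = contractionCoeff f Q W :=
    ⟨_, EReal.coe_toENNReal (key (1 / 2) (by norm_num) (by norm_num)).1⟩
  rw [← hM, ← EReal.coe_ennreal_mul, EReal.coe_ennreal_le_coe_ennreal_iff]
  refine lintegral_chiSq_le_of_forall_mixture hh.measurable fun ε he0 he1 => ?_
  have h1 := (key ε he0 he1).2
  rw [← hM, ← EReal.coe_ennreal_mul, EReal.coe_ennreal_le_coe_ennreal_iff] at h1
  have h2 : ENNReal.ofReal (c * ε ^ 2) ≠ 0 := (ENNReal.ofReal_pos.2 (by positivity)).ne'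
  rw [← ENNReal.mul_le_mul_iff_right h2 ENNReal.ofReal_ne_top]
  refine (hh.le_mixture hf he0 he1).trans (h1.trans ?_)
  refine (mul_le_mul_left (hg.mixture_le hf he0 he1) M).trans (le_of_eq ?_)
  ring

end Contraction

/-! ### Absolute continuity and the main theorem -/

lemma tendsto_kFun_one_div : Tendsto (fun u => kFun 1 u / u) atTop atTop := by
  refine Real.tendsto_log_atTop.congr' ?_
  filter_upwards [eventually_ne_atTop 0] with u hu
  simp [kFun, hu]

lemma tendsto_sFun_one_div : Tendsto (fun u => sFun 1 u / u) atTop atTop := by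
  refine Real.tendsto_log_atTop.congr' ?_
  filter_upwards [eventually_ne_atTop 0] with u hu
  simp [sFun, hu]

theorem mainTheorem10 {X Y : Type*} [MeasurableSpace X] [MeasurableSingletonClass X]
    [MeasurableSpace Y] (Q : Measure X) [IsProbabilityMeasure Q]
    (hQ : ∀ x : X, Q ≠ Measure.dirac x) (W : Kernel X Y) [IsMarkovKernel W]
    (α : ℝ) (hα : α ∈ Set.Ioc (0 : ℝ) 1) :
    (contractionCoeff chiSqFun Q W ≤ contractionCoeff (kFun α) Q W ∧
      contractionCoeff chiSqFun Q W ≤ contractionCoeff (sFun α) Q W) ∧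
    ((∃ S : Finset X, Q (S : Set X)ᶜ = 0) → (α < 1 → ∀ x : X, 0 < Q {x}) →
      contractionCoeff (kFun α) Q W ≤
          ((1 / (α * minMass Q) : ℝ) : EReal) * contractionCoeff chiSqFun Q W ∧
        contractionCoeff (sFun α) Q W ≤
          ((((1 - α) * Real.log (1 / α) + 2 * α - 1) /
              ((1 - 3 * α + 3 * α ^ 2) * minMass Q) : ℝ) : EReal) *
            contractionCoeff chiSqFun Q W) := by
  have hk := comparableChiSq_kFun hα
  have hs := comparableChiSq_sFun hα
  refine ⟨⟨contractionCoeff_chiSq_le hk, contractionCoeff_chiSq_le hs⟩, ?_⟩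
  rintro ⟨S, hS⟩ hpos
  -- For `α < 1` the generators grow at most linearly, so a finite divergence does not force `P ≪
  -- Q`; full support does, as only the empty set is `Q`-null. For `α = 1` both generators are `t
  -- log t`, and superlinear growth is used instead.
  have hac : ∀ P : Measure X, α < 1 → P ≪ Q := by
    intro P hα1 s hs0
    have : s = ∅ := by
      by_contra hne
      obtain ⟨x, hx⟩ := nonempty_iff_ne_empty.2 hne
      exact (hpos hα1 x).ne' (measure_mono_null (singleton_subset_iff.2 hx) hs0)
    rw [this, measure_empty]
  constructor
  · have h := contractionCoeff_le_mul_chiSq (W := W) hk (pinskerBound_kFun hα)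
      (fun t ht => kFun_sub_le hα ht) hS ?_
    · have e : α / (2 * (α ^ 2 / 2) * minMass Q) = 1 / (α * minMass Q) := by
        have := hα.1.ne'
        have := (minMass_pos hS).ne'
        field_simp
      rwa [e] at h
    · intro P hP hlt
      rcases hα.2.lt_or_eq with h1 | rfl
      · exact hac P h1
      · exact absolutelyContinuous_of_fDiv_lt_top hk tendsto_kFun_one_div hlt
  · have h := contractionCoeff_le_mul_chiSq (W := W) hs (pinskerBound_sFun hα)
      (fun t ht => sFun_sub_le hα ht) hS ?_
    · rwa [mul_div_cancel₀ _ (two_ne_zero' ℝ)] at h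
    · intro P hP hlt
      rcases hα.2.lt_or_eq with h1 | rfl
      · exact hac P h1
      · exact absolutelyContinuous_of_fDiv_lt_top hs tendsto_sFun_one_div hlt
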